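/- Let $(\Omega,\mathcal B,\mu)$ be a $\sigma$-finite measure space with $\mu(\Omega)=\infty$, let $T:\Omega\to\Omega$ be an invertible (bijective, with $T$ and $T^{-1}$ measurable), measure-preserving, ergodic and conservative transformation, and let $f:\Omega\to\mathbb R$ be bounded and measurable. (Conservative means that there is no $W\in\mathcal B$ with $\mu(W)>0$ such that the sets $T^{-n}W$, $n\ge 0$, are pairwise disjoint.) For $\omega\in\Omega$ let $H_\omega$ be the bounded self-adjoint operator on $\ell^2(\mathbb Z)$ given by $$(H_\omega u)_n = u_{n-1}+u_{n+1}+f(T^n\omega)\,u_n .$$ For a bounded self-adjoint operator $H$ and a vector $\psi$, let $\mu_\psi$ be the spectral measure of $\psi$, i.e. $\int g\,d\mu_\psi=\langle\psi,g(H)\psi\rangle$ for all $g \in C_c(\mathbb R)$. Let $\mathcal H_{\rm ac}$, $\mathcal H_{\rm sc}$, $\mathcal H_{\rm pp}$ be the subspaces of those $\psi$ for which $\mu_\psi$ is, respectively, absolutely continuous with respect to Lebesgue measure, singular with respect to Lebesgue measure and without atoms, and concentrated on a countable set (i.e. giving measure zero to the complement of some countable set). For $\bullet\in\{{\rm ac},{\rm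 sc},{\rm pp}\}$ let $\sigma_\bullet(H)$ be the spectrum of the restriction of $H$ to its invariant subspace $\mathcal H_\bullet$ (empty if $\mathcal H_\bullet=\{0\}$). Theorem. There exist compact sets $\Sigma_{\rm ac},\Sigma_{\rm sc},\Sigma_{\rm pp}\subseteq\mathbb R$ such that for $\mu$-almost every $\omega\in\Omega$ one has $\sigma_\bullet(H_\omega)=\Sigma_\bullet$ for every $\bullet\in\{{\rm ac},{\rm sc},{\rm pp}\}$. -/

import Mathlib

open MeasureTheory CompactlySupported
open scoped InnerProductSpace ENNReal

/-! ### Spectral measures and spectral types of a bounded self-adjoint operator -/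

section SpectralTypes

variable {E : Type*} [NormedAddCommGroup E] [InnerProductSpace ℂ E] [CompleteSpace E]

/-- The positive functional `g ↦ ⟨ψ, g(H) ψ⟩` on compactly supported continuous functions, where
`g(H)` is given by the continuous functional calculus. -/
noncomputable def spectralFunctional (H : selfAdjoint (E →L[ℂ] E)) (ψ : E) :
    C_c(ℝ, ℝ) →ₚ[ℝ] ℝ :=
  PositiveLinearMap.mk₀
    { toFun := fun g => (⟪ψ, cfc (⇑g) (H : E →L[ℂ] E) ψ⟫_ℂ).re
      map_add' := fun g h => by
        have := cfc_add (a := (H : E →L[ℂ] E)) (⇑g) (⇑h) g.continuous.continuousOn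
          h.continuous.continuousOn
        have e : (⇑(g + h) : ℝ → ℝ) = fun x => g x + h x := rfl
        rw [e, this]
        simp
      map_smul' := fun c g => by
        have := cfc_smul c (⇑g) (H : E →L[ℂ] E) g.continuous.continuousOn
        have e : (⇑(c • g) : ℝ → ℝ) = fun x => c • g x := rfl
        rw [e, this]
        simp [← Complex.coe_smul] }
    (fun g hg => by
      have h0 : 0 ≤ cfc (⇑g) (H : E →L[ℂ] E) := cfc_nonneg fun x _ => hg x
      rw [ContinuousLinearMap.nonneg_iff_isPositive] at h0
      exact h0.re_inner_nonneg_right ψ)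

/-- The spectral measure of `ψ`: the regular Borel measure `μ_ψ` on `ℝ` with
`∫ g dμ_ψ = ⟨ψ, g(H) ψ⟩` for all compactly supported continuous `g`. -/
noncomputable def spectralMeasure (H : selfAdjoint (E →L[ℂ] E)) (ψ : E) : Measure ℝ :=
  RealRMK.rieszMeasure (spectralFunctional H ψ)

instance spectralMeasure_regular (H : selfAdjoint (E →L[ℂ] E)) (ψ : E) :
    (spectralMeasure H ψ).Regular :=
  RealRMK.regular_rieszMeasure _

theorem integral_spectralMeasure (H : selfAdjoint (E →L[ℂ] E)) (ψ : E) (g : C_c(ℝ, ℝ)) :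
    ∫ x, g x ∂(spectralMeasure H ψ) = (⟪ψ, cfc (⇑g) (H : E →L[ℂ] E) ψ⟫_ℂ).re :=
  RealRMK.integral_rieszMeasure (spectralFunctional H ψ) g

theorem spectralMeasure_zero (H : selfAdjoint (E →L[ℂ] E)) :
    spectralMeasure H (0 : E) = 0 :=
  Measure.ext_of_integral_eq_on_compactlySupported fun g => by
    rw [integral_spectralMeasure]; simp

theorem spectralMeasure_add_add_sub (H : selfAdjoint (E →L[ℂ] E)) (φ ψ : E) :
    spectralMeasure H (φ + ψ) + spectralMeasure H (φ - ψ) =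
      (spectralMeasure H φ + spectralMeasure H φ) +
        (spectralMeasure H ψ + spectralMeasure H ψ) := by
  have hlf : ∀ μ ν : Measure ℝ, IsLocallyFiniteMeasure μ → IsLocallyFiniteMeasure ν →
      IsLocallyFiniteMeasure (μ + ν) := fun μ ν hμ hν => by
    have : IsFiniteMeasureOnCompacts (μ + ν) := ⟨fun K hK => by
      rw [Measure.add_apply]
      exact ENNReal.add_lt_top.mpr ⟨hK.measure_lt_top, hK.measure_lt_top⟩⟩
    infer_instance
  have hs : ∀ χ : E, IsLocallyFiniteMeasure (spectralMeasure H χ) := fun χ => inferInstance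
  have hl := hlf _ _ (hs (φ + ψ)) (hs (φ - ψ))
  have hr (χ : E) := hlf _ _ (hs χ) (hs χ)
  have hrr := hlf _ _ (hr φ) (hr ψ)
  refine Measure.ext_of_integral_eq_on_compactlySupported fun g => ?_
  have hi : ∀ χ : E, Integrable (⇑g) (spectralMeasure H χ) := fun χ =>
    g.continuous.integrable_of_hasCompactSupport g.hasCompactSupport
  rw [integral_add_measure (hi _) (hi _),
    integral_add_measure ((hi _).add_measure (hi _)) ((hi _).add_measure (hi _)),
    integral_add_measure (hi _) (hi _), integral_add_measure (hi _) (hi _)]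
  simp only [integral_spectralMeasure, map_add, map_sub, inner_add_left, inner_add_right,
    inner_sub_left, inner_sub_right, Complex.add_re, Complex.sub_re]
  ring

theorem spectralMeasure_smul (H : selfAdjoint (E →L[ℂ] E)) (c : ℂ) (ψ : E) :
    spectralMeasure H (c • ψ) = (‖c‖₊ ^ 2) • spectralMeasure H ψ := by
  refine Measure.ext_of_integral_eq_on_compactlySupported fun g => ?_
  rw [integral_smul_nnreal_measure, integral_spectralMeasure, integral_spectralMeasure]
  simp only [map_smul, inner_smul_left, inner_smul_right]
  rw [← mul_assoc, mul_comm c, ← Complex.normSq_eq_conj_mul_self, Complex.normSq_eq_norm_sq,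
    Complex.re_ofReal_mul, NNReal.smul_def, smul_eq_mul]
  simp

theorem spectralMeasure_apply_self (H : selfAdjoint (E →L[ℂ] E)) (ψ : E) :
    spectralMeasure H ((H : E →L[ℂ] E) ψ) ≪ spectralMeasure H ψ := by
  have hfin : IsLocallyFiniteMeasure
      ((spectralMeasure H ψ).withDensity fun x => ((‖x‖₊ ^ 2 : NNReal) : ℝ≥0∞)) :=
    IsLocallyFiniteMeasure.withDensity_coe (by fun_prop)
  have key : spectralMeasure H ((H : E →L[ℂ] E) ψ) =
      (spectralMeasure H ψ).withDensity fun x => ((‖x‖₊ ^ 2 : NNReal) : ℝ≥0∞) := by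
    refine Measure.ext_of_integral_eq_on_compactlySupported fun g => ?_
    rw [integral_withDensity_eq_integral_smul (by fun_prop)]
    let k : C_c(ℝ, ℝ) :=
      ⟨⟨fun x => x * (g x * x), by fun_prop⟩,
        (g.hasCompactSupport.mul_right (f' := fun x : ℝ => x)).mul_left⟩
    have hk : ∀ x, (‖x‖₊ ^ 2 : NNReal) • g x = k x := fun x => by
      change _ = x * (g x * x)
      rw [NNReal.smul_def, smul_eq_mul]
      push_cast
      rw [Real.norm_eq_abs, sq_abs]
      ring
    simp only [hk]
    rw [integral_spectralMeasure, integral_spectralMeasure]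
    have hH : IsSelfAdjoint (H : E →L[ℂ] E) := H.2
    have e : cfc (⇑k) (H : E →L[ℂ] E) =
        (H : E →L[ℂ] E) * (cfc (⇑g) (H : E →L[ℂ] E) * (H : E →L[ℂ] E)) := by
      have h1 := cfc_mul (fun x : ℝ => x) (fun x : ℝ => g x * x) (H : E →L[ℂ] E)
        continuousOn_id (by fun_prop)
      have h2 := cfc_mul (⇑g) (fun x : ℝ => x) (H : E →L[ℂ] E) (by fun_prop) continuousOn_id
      rw [h2, cfc_id' ℝ (H : E →L[ℂ] E)] at h1
      exact h1
    rw [e]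
    have hs := (ContinuousLinearMap.isSelfAdjoint_iff_isSymmetric.mp hH)
      ψ (cfc (⇑g) (H : E →L[ℂ] E) ((H : E →L[ℂ] E) ψ))
    simp only [ContinuousLinearMap.coe_coe] at hs
    rw [hs]
    rfl
  rw [key]
  exact withDensity_absolutelyContinuous _ _

/-- The vectors whose spectral measure has the property `P`, a subspace if `P` is stable under
sums and passes to absolutely continuous measures. -/
noncomputable def spectralSubspace (H : selfAdjoint (E →L[ℂ] E)) (P : Measure ℝ → Prop)
    (h0 : P 0) (hadd : ∀ μ ν, P μ → P ν → P (μ + ν)) (hac : ∀ μ ν, ν ≪ μ → P μ → P ν) :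
    Submodule ℂ E where
  carrier := {ψ | P (spectralMeasure H ψ)}
  zero_mem' := by
    change P _
    rw [spectralMeasure_zero]
    exact h0
  add_mem' := fun {φ ψ} hφ hψ => by
    refine hac _ _ (Measure.absolutelyContinuous_of_le ?_)
      (hadd _ _ (hadd _ _ hφ hφ) (hadd _ _ hψ hψ))
    rw [← spectralMeasure_add_add_sub]
    exact Measure.le_add_right le_rfl
  smul_mem' := fun c ψ hψ => by
    refine hac _ _ ?_ hψ
    rw [spectralMeasure_smul]
    exact Measure.smul_absolutelyContinuous

/-- The absolutely continuous subspace of `H`. -/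
noncomputable def acSubspace (H : selfAdjoint (E →L[ℂ] E)) : Submodule ℂ E :=
  spectralSubspace H (fun μ => μ ≪ volume) (Measure.AbsolutelyContinuous.zero _)
    (fun _ _ hμ hν => hμ.add_left hν) (fun _ _ h hμ => h.trans hμ)

/-- The singular continuous subspace of `H`. -/
noncomputable def scSubspace (H : selfAdjoint (E →L[ℂ] E)) : Submodule ℂ E :=
  spectralSubspace H (fun μ => μ ⟂ₘ volume ∧ ∀ x, μ {x} = 0)
    ⟨Measure.MutuallySingular.zero_left, fun _ => rfl⟩
    (fun _ _ hμ hν => ⟨hμ.1.add_left hν.1, fun x => by simp [hμ.2 x, hν.2 x]⟩)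
    (fun _ _ h hμ => ⟨hμ.1.mono_ac h Measure.AbsolutelyContinuous.rfl, fun x => h (hμ.2 x)⟩)

/-- The pure point subspace of `H`: the spectral measure lives on a countable set. -/
noncomputable def ppSubspace (H : selfAdjoint (E →L[ℂ] E)) : Submodule ℂ E :=
  spectralSubspace H (fun μ => ∃ S : Set ℝ, S.Countable ∧ μ Sᶜ = 0)
    ⟨∅, Set.countable_empty, rfl⟩
    (fun μ ν hμ hν => by
      obtain ⟨S, hS, hμS⟩ := hμ
      obtain ⟨R, hR, hνR⟩ := hν
      refine ⟨S ∪ R, hS.union hR, ?_⟩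
      have h1 : μ (S ∪ R)ᶜ = 0 :=
        measure_mono_null (Set.compl_subset_compl.mpr Set.subset_union_left) hμS
      have h2 : ν (S ∪ R)ᶜ = 0 :=
        measure_mono_null (Set.compl_subset_compl.mpr Set.subset_union_right) hνR
      rw [Measure.add_apply, h1, h2, add_zero])
    (fun _ _ h hμ => by
      obtain ⟨S, hS, hμS⟩ := hμ
      exact ⟨S, hS, h hμS⟩)

theorem acSubspace_invariant (H : selfAdjoint (E →L[ℂ] E)) :
    ∀ ψ ∈ acSubspace H, (H : E →L[ℂ] E) ψ ∈ acSubspace H := fun ψ hψ =>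
  Measure.AbsolutelyContinuous.trans (spectralMeasure_apply_self H ψ) hψ

theorem scSubspace_invariant (H : selfAdjoint (E →L[ℂ] E)) :
    ∀ ψ ∈ scSubspace H, (H : E →L[ℂ] E) ψ ∈ scSubspace H := fun ψ hψ =>
  ⟨hψ.1.mono_ac (spectralMeasure_apply_self H ψ) Measure.AbsolutelyContinuous.rfl,
    fun x => spectralMeasure_apply_self H ψ (hψ.2 x)⟩

theorem ppSubspace_invariant (H : selfAdjoint (E →L[ℂ] E)) :
    ∀ ψ ∈ ppSubspace H, (H : E →L[ℂ] E) ψ ∈ ppSubspace H := fun ψ hψ => by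
  obtain ⟨S, hS, hμS⟩ := hψ
  exact ⟨S, hS, spectralMeasure_apply_self H ψ hμS⟩

/-- The (real) spectrum of the restriction of `H` to an invariant subspace `M`, as an element of
the algebra of bounded operators on `M`. -/
noncomputable def restrictedSpectrum (H : selfAdjoint (E →L[ℂ] E)) (M : Submodule ℂ E)
    (hM : ∀ ψ ∈ M, (H : E →L[ℂ] E) ψ ∈ M) : Set ℝ :=
  spectrum ℝ ((((H : E →L[ℂ] E).comp M.subtypeL).codRestrict M fun ψ => hM ψ ψ.2) : M →L[ℂ] M)

/-- The absolutely continuous spectrum of `H`. -/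
noncomputable def acSpectrum (H : selfAdjoint (E →L[ℂ] E)) : Set ℝ :=
  restrictedSpectrum H (acSubspace H) (acSubspace_invariant H)

/-- The singular continuous spectrum of `H`. -/
noncomputable def scSpectrum (H : selfAdjoint (E →L[ℂ] E)) : Set ℝ :=
  restrictedSpectrum H (scSubspace H) (scSubspace_invariant H)

/-- The pure point spectrum of `H`: the spectrum of the restriction to the pure point subspace
(that is, the closure of the set of eigenvalues). -/
noncomputable def ppSpectrum (H : selfAdjoint (E →L[ℂ] E)) : Set ℝ :=
  restrictedSpectrum H (ppSubspace H) (ppSubspace_invariant H)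

end SpectralTypes

/-! ### Discrete Schrödinger operators on `ℓ²(ℤ)` -/

/-- The complex Hilbert space `ℓ²(ℤ)`. -/
abbrev EllTwo : Type := lp (fun _ : ℤ => ℂ) 2

theorem memℓp_comp_equiv (e : ℤ ≃ ℤ) (u : EllTwo) :
    Memℓp (E := fun _ : ℤ => ℂ) (fun n => u (e n)) 2 := by
  have h2 : (0 : ℝ) < (2 : ℝ≥0∞).toReal := by norm_num
  have hu : Summable fun n : ℤ => ‖u n‖ ^ (2 : ℝ≥0∞).toReal := (lp.memℓp u).summable h2
  exact memℓp_gen (hu.comp_injective e.injective)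

theorem memℓp_schrodinger (V : ℤ → ℝ) (hV : ∃ C : ℝ, ∀ n, |V n| ≤ C) (u : EllTwo) :
    Memℓp (fun n : ℤ => u (n - 1) + u (n + 1) + (V n : ℂ) * u n) 2 := by
  have h2 : (0 : ℝ) < (2 : ℝ≥0∞).toReal := by norm_num
  have hu : Summable fun n : ℤ => ‖u n‖ ^ (2 : ℝ≥0∞).toReal := (lp.memℓp u).summable h2
  have hL : Memℓp (fun n : ℤ => u (n - 1)) 2 :=
    memℓp_comp_equiv (Equiv.subRight (1 : ℤ)) u
  have hR : Memℓp (fun n : ℤ => u (n + 1)) 2 :=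
    memℓp_comp_equiv (Equiv.addRight (1 : ℤ)) u
  obtain ⟨C, hC⟩ := hV
  have hM : Memℓp (fun n : ℤ => (V n : ℂ) * u n) 2 := by
    refine memℓp_gen (Summable.of_nonneg_of_le (fun n => by positivity) (fun n => ?_)
      (hu.mul_left (C ^ (2 : ℝ≥0∞).toReal)))
    rw [norm_mul, Complex.norm_real, Real.norm_eq_abs,
      Real.mul_rpow (abs_nonneg _) (norm_nonneg _)]
    gcongr
    exact hC n
  exact (hL.add hR).add hM

/-- The map `u ↦ (n ↦ u (n-1) + u (n+1) + V n * u n)` on `ℓ²(ℤ)`. -/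
noncomputable def schrodingerLinearMap (V : ℤ → ℝ) (hV : ∃ C : ℝ, ∀ n, |V n| ≤ C) :
    EllTwo →ₗ[ℂ] EllTwo where
  toFun u := ⟨fun n : ℤ => u (n - 1) + u (n + 1) + (V n : ℂ) * u n, memℓp_schrodinger V hV u⟩
  map_add' u v := by
    ext n
    change (u (n - 1) + v (n - 1)) + (u (n + 1) + v (n + 1)) + (V n : ℂ) * (u n + v n) =
      (u (n - 1) + u (n + 1) + (V n : ℂ) * u n) + (v (n - 1) + v (n + 1) + (V n : ℂ) * v n)
    ring
  map_smul' c u := by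
    ext n
    change c * u (n - 1) + c * u (n + 1) + (V n : ℂ) * (c * u n) =
      c * (u (n - 1) + u (n + 1) + (V n : ℂ) * u n)
    ring

theorem schrodingerLinearMap_isSymmetric (V : ℤ → ℝ) (hV : ∃ C : ℝ, ∀ n, |V n| ≤ C) :
    (schrodingerLinearMap V hV).IsSymmetric := by
  intro u v
  have hsum : ∀ a b : ℤ → ℂ, Memℓp (E := fun _ => ℂ) a 2 → Memℓp (E := fun _ => ℂ) b 2 →
      Summable fun n => ⟪a n, b n⟫_ℂ := fun a b ha hb =>
    lp.summable_inner (𝕜 := ℂ) (⟨a, ha⟩ : EllTwo) (⟨b, hb⟩ : EllTwo)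
  have hL : ∀ w : EllTwo, Memℓp (E := fun _ => ℂ) (fun n : ℤ => w (n - 1)) 2 := fun w =>
    memℓp_comp_equiv (Equiv.subRight (1 : ℤ)) w
  have hR : ∀ w : EllTwo, Memℓp (E := fun _ => ℂ) (fun n : ℤ => w (n + 1)) 2 := fun w =>
    memℓp_comp_equiv (Equiv.addRight (1 : ℤ)) w
  have hM : ∀ w : EllTwo, Memℓp (E := fun _ => ℂ) (fun n : ℤ => (V n : ℂ) * w n) 2 := fun w => by
    have := (memℓp_schrodinger V hV w).sub ((hL w).add (hR w))
    convert! this using 1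
    funext n
    simp
  rw [lp.inner_eq_tsum, lp.inner_eq_tsum]
  have e1 : ∀ n : ℤ, ⟪schrodingerLinearMap V hV u n, v n⟫_ℂ =
      ⟪u (n - 1), v n⟫_ℂ + ⟪u (n + 1), v n⟫_ℂ + ⟪(V n : ℂ) * u n, v n⟫_ℂ := fun n => by
    change ⟪u (n - 1) + u (n + 1) + (V n : ℂ) * u n, v n⟫_ℂ = _
    rw [inner_add_left, inner_add_left]
  have e2 : ∀ n : ℤ, ⟪u n, schrodingerLinearMap V hV v n⟫_ℂ =
      ⟪u n, v (n - 1)⟫_ℂ + ⟪u n, v (n + 1)⟫_ℂ + ⟪u n, (V n : ℂ) * v n⟫_ℂ := fun n => by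
    change ⟪u n, v (n - 1) + v (n + 1) + (V n : ℂ) * v n⟫_ℂ = _
    rw [inner_add_right, inner_add_right]
  have t1 : ∑' n : ℤ, ⟪u (n - 1), v n⟫_ℂ = ∑' n : ℤ, ⟪u n, v (n + 1)⟫_ℂ := by
    rw [← (Equiv.addRight (1 : ℤ)).tsum_eq]
    simp
  have t2 : ∑' n : ℤ, ⟪u (n + 1), v n⟫_ℂ = ∑' n : ℤ, ⟪u n, v (n - 1)⟫_ℂ := by
    rw [← (Equiv.subRight (1 : ℤ)).tsum_eq]
    simp
  have t3 : ∀ n : ℤ, ⟪(V n : ℂ) * u n, v n⟫_ℂ = ⟪u n, (V n : ℂ) * v n⟫_ℂ := fun n => by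
    simp only [RCLike.inner_apply, map_mul, Complex.conj_ofReal]
    ring
  rw [tsum_congr e1, tsum_congr e2,
    ((hsum _ _ (hL u) (lp.memℓp v)).add (hsum _ _ (hR u) (lp.memℓp v))).tsum_add
      (hsum _ _ (hM u) (lp.memℓp v)),
    (hsum _ _ (hL u) (lp.memℓp v)).tsum_add (hsum _ _ (hR u) (lp.memℓp v)),
    ((hsum _ _ (lp.memℓp u) (hL v)).add (hsum _ _ (lp.memℓp u) (hR v))).tsum_add
      (hsum _ _ (lp.memℓp u) (hM v)),
    (hsum _ _ (lp.memℓp u) (hL v)).tsum_add (hsum _ _ (lp.memℓp u) (hR v)),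
    t1, t2, tsum_congr t3]
  ring

/-- The bounded self-adjoint operator `(H u)_n = u_{n-1} + u_{n+1} + V_n u_n` on `ℓ²(ℤ)`, for a
bounded real potential `V`; an everywhere defined symmetric operator is bounded. -/
noncomputable def schrodinger (V : ℤ → ℝ) (hV : ∃ C : ℝ, ∀ n, |V n| ≤ C) :
    selfAdjoint (EllTwo →L[ℂ] EllTwo) :=
  (schrodingerLinearMap_isSymmetric V hV).toSelfAdjoint

theorem schrodinger_apply (V : ℤ → ℝ) (hV : ∃ C : ℝ, ∀ n, |V n| ≤ C) (u : EllTwo) (n : ℤ) :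
    (schrodinger V hV : EllTwo →L[ℂ] EllTwo) u n = u (n - 1) + u (n + 1) + (V n : ℂ) * u n :=
  rfl

/-- The operator `H_ω` with potential `V_ω(n) = f (T^n ω)`, for an invertible map `T` and a bounded
function `f`. -/
noncomputable def dynSchrodinger {Ω : Type*} [MeasurableSpace Ω] (T : Ω ≃ᵐ Ω) (f : Ω → ℝ)
    (hf : ∃ C : ℝ, ∀ ω, |f ω| ≤ C) (ω : Ω) : selfAdjoint (EllTwo →L[ℂ] EllTwo) :=
  schrodinger (fun n => f (((T.toEquiv : Equiv.Perm Ω) ^ n) ω))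
    (hf.imp fun _ hC _ => hC _)

/-! Fix one of the three types and call it P. A point l lies in the type-P spectrum of H_ω exactly
when every rational interval I containing l is charged by the spectral measure of some vector of
type P (`mem_restrictedSpectrum_spectralSubspace_iff_rat`). That spectrum is therefore encoded by
countably many events B_I in Ω. If each B_I is measurable and T-invariant, ergodicity makes it null
or conull, so almost all ω give the same answers and hence the same set.

The difficulty is the quantifier over all vectors in B_I. It is removed by
`exists_spectralMeasure_ne_zero_iff`: only the type-P parts of the spectral measures of the site
vectors δ_k need testing. Such a part is a restriction to a carrier A_k(ω), which can be chosen
jointly measurable in ω and the energy by a Lebesgue decomposition of kernels and the measurability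
of the set of atoms. Measurability of the spectral measures in ω comes from their moments, and
invariance from the fact that δ_k at Tω and δ_{k+1} at ω have equal moments. -/

open Filter Topology

/-! ### Spectral measures and continuous functional calculus -/

section SpectralMeasure

variable {E : Type*} [NormedAddCommGroup E] [InnerProductSpace ℂ E] [CompleteSpace E]
variable (H : selfAdjoint (E →L[ℂ] E))

theorem abs_le_norm_of_mem_spectrum {x : ℝ} (hx : x ∈ spectrum ℝ (H : E →L[ℂ] E)) :
    |x| ≤ ‖(H : E →L[ℂ] E)‖ := by
  rcases subsingleton_or_nontrivial E with hE | hE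
  · have : Subsingleton (E →L[ℂ] E) := inferInstance
    exact absurd hx (by simp [spectrum.of_subsingleton])
  · simpa using spectrum.norm_le_norm_of_mem hx

/-- A spectral measure is carried by the ball whose radius is the norm of the operator. -/
theorem spectralMeasure_compl_Icc (ψ : E) :
    spectralMeasure H ψ (Set.Icc (-‖(H : E →L[ℂ] E)‖) ‖(H : E →L[ℂ] E)‖)ᶜ = 0 := by
  set U := (Set.Icc (-‖(H : E →L[ℂ] E)‖) ‖(H : E →L[ℂ] E)‖)ᶜ with hU
  have hUo : IsOpen U := isClosed_Icc.isOpen_compl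
  rw [hUo.measure_eq_iSup_isCompact]
  simp only [ENNReal.iSup_eq_zero]
  intro K hKU hK
  -- A Urysohn function equal to 1 on K and vanishing on the spectrum: g(H) = 0, yet its integral
  -- dominates the mass of K.
  obtain ⟨g, hg1, hg0, hgc, hg01⟩ := exists_continuous_one_zero_of_isCompact hK
    hUo.isClosed_compl (Set.disjoint_compl_right_iff_subset.mpr hKU)
  let k : C_c(ℝ, ℝ) := ⟨g, hgc⟩
  have h1 : ∫ x, g x ∂(spectralMeasure H ψ) = 0 := by
    have hz : cfc (⇑k) (H : E →L[ℂ] E) = 0 := by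
      rw [← cfc_zero (R := ℝ) (a := (H : E →L[ℂ] E))]
      refine cfc_congr fun x hx => hg0 ?_
      rw [hU, compl_compl]
      exact abs_le.mp (abs_le_norm_of_mem_spectrum H hx)
    exact (integral_spectralMeasure H ψ k).trans (by rw [hz]; simp)
  have hint : Integrable (⇑g) (spectralMeasure H ψ) :=
    g.continuous.integrable_of_hasCompactSupport hgc
  have h2 : (spectralMeasure H ψ).real K ≤ ∫ x, g x ∂(spectralMeasure H ψ) := by
    rw [← integral_indicator_one hK.measurableSet]
    refine integral_mono ((integrable_indicator_iff hK.measurableSet).mpr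
      (integrableOn_const hK.measure_lt_top.ne)) hint fun x => ?_
    by_cases hx : x ∈ K
    · simp [hx, hg1 hx]
    · simpa [hx] using (hg01 x).1
  rw [h1] at h2
  have := le_antisymm h2 measureReal_nonneg
  exact (measureReal_eq_zero_iff hK.measure_lt_top.ne).mp this

instance isFiniteMeasure_spectralMeasure (ψ : E) : IsFiniteMeasure (spectralMeasure H ψ) := by
  constructor
  have h := measure_union_le (μ := spectralMeasure H ψ)
    (Set.Icc (-‖(H : E →L[ℂ] E)‖) ‖(H : E →L[ℂ] E)‖)
    (Set.Icc (-‖(H : E →L[ℂ] E)‖) ‖(H : E →L[ℂ] E)‖)ᶜ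
  rw [Set.union_compl_self, spectralMeasure_compl_Icc, add_zero] at h
  exact h.trans_lt isCompact_Icc.measure_lt_top

theorem ae_mem_Icc_spectralMeasure (ψ : E) : ∀ᵐ x ∂(spectralMeasure H ψ),
    x ∈ Set.Icc (-‖(H : E →L[ℂ] E)‖) ‖(H : E →L[ℂ] E)‖ :=
  spectralMeasure_compl_Icc H ψ

theorem integrable_spectralMeasure (ψ : E) {g : ℝ → ℝ} (hg : Continuous g) :
    Integrable g (spectralMeasure H ψ) := by
  obtain ⟨C, hC⟩ := isCompact_Icc.exists_bound_of_continuousOn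
    (s := Set.Icc (-‖(H : E →L[ℂ] E)‖) ‖(H : E →L[ℂ] E)‖) hg.continuousOn
  refine Integrable.of_bound hg.aestronglyMeasurable C ?_
  filter_upwards [ae_mem_Icc_spectralMeasure H ψ] with x hx using hC x hx

/-- The defining formula of the spectral measure holds for all continuous functions. -/
theorem integral_spectralMeasure_of_continuous (ψ : E) {g : ℝ → ℝ} (hg : Continuous g) :
    ∫ x, g x ∂(spectralMeasure H ψ) = (⟪ψ, cfc g (H : E →L[ℂ] E) ψ⟫_ℂ).re := by
  obtain ⟨χ, hχ1, -, hχc, -⟩ := exists_continuous_one_zero_of_isCompact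
    (isCompact_Icc (a := -‖(H : E →L[ℂ] E)‖) (b := ‖(H : E →L[ℂ] E)‖)) isClosed_empty
    (Set.disjoint_empty _)
  let k : C_c(ℝ, ℝ) := ⟨⟨fun x => χ x * g x, by fun_prop⟩, hχc.mul_right⟩
  have h1 : ∫ x, k x ∂(spectralMeasure H ψ) = ∫ x, g x ∂(spectralMeasure H ψ) := by
    refine integral_congr_ae ?_
    filter_upwards [ae_mem_Icc_spectralMeasure H ψ] with x hx
    change χ x * g x = g x
    simp [hχ1 hx]
  have h2 : cfc (⇑k) (H : E →L[ℂ] E) = cfc g (H : E →L[ℂ] E) := by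
    refine cfc_congr fun x hx => ?_
    change χ x * g x = g x
    simp [hχ1 (show x ∈ _ from abs_le.mp (abs_le_norm_of_mem_spectrum H hx))]
  rw [← h1, integral_spectralMeasure, h2]

theorem inner_cfc_left (g : ℝ → ℝ) (φ ψ : E) :
    ⟪cfc g (H : E →L[ℂ] E) φ, ψ⟫_ℂ = ⟪φ, cfc g (H : E →L[ℂ] E) ψ⟫_ℂ :=
  ContinuousLinearMap.isSelfAdjoint_iff_isSymmetric.mp
    (cfc_predicate g (H : E →L[ℂ] E)) φ ψ

/-- Self-adjointness and multiplicativity of the calculus. Taking h = 1 yields the L² isometry g ↦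
g(H)ψ; taking h as a test function identifies the spectral measure of g(H)ψ as g² times that of ψ.
-/
theorem re_inner_cfc_cfc (ψ : E) {g h : ℝ → ℝ} (hg : Continuous g) (hh : Continuous h) :
    (⟪cfc g (H : E →L[ℂ] E) ψ, cfc h (H : E →L[ℂ] E) (cfc g (H : E →L[ℂ] E) ψ)⟫_ℂ).re =
      ∫ x, g x ^ 2 * h x ∂(spectralMeasure H ψ) := by
  have e : (fun x => g x ^ 2 * h x) = fun x => g x * (h x * g x) := by
    funext x; ring
  rw [e, integral_spectralMeasure_of_continuous H ψ (by fun_prop), inner_cfc_left,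
    cfc_mul g (fun x => h x * g x) _ hg.continuousOn (by fun_prop),
    cfc_mul h g _ hh.continuousOn hg.continuousOn]
  rfl

theorem norm_cfc_apply_sq (ψ : E) {g : ℝ → ℝ} (hg : Continuous g) :
    ‖cfc g (H : E →L[ℂ] E) ψ‖ ^ 2 = ∫ x, g x ^ 2 ∂(spectralMeasure H ψ) := by
  have h := re_inner_cfc_cfc H ψ hg (h := fun _ => 1) continuous_const
  have h1 : cfc (fun _ : ℝ => (1 : ℝ)) (H : E →L[ℂ] E) = 1 := cfc_one ℝ _
  rw [h1] at h
  simp only [mul_one, one_apply_eq_self] at h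
  rw [← h]
  exact (inner_self_eq_norm_sq (𝕜 := ℂ) _).symm

theorem measureReal_univ_spectralMeasure (ψ : E) :
    (spectralMeasure H ψ).real Set.univ = ‖ψ‖ ^ 2 := by
  have h := norm_cfc_apply_sq H ψ (g := fun _ => 1) continuous_const
  have h1 : cfc (fun _ : ℝ => (1 : ℝ)) (H : E →L[ℂ] E) = 1 := cfc_one ℝ _
  rw [h1] at h
  simpa using h.symm

theorem spectralMeasure_eq_zero_iff (ψ : E) : spectralMeasure H ψ = 0 ↔ ψ = 0 := by
  rw [← Measure.measure_univ_eq_zero, ← measureReal_eq_zero_iff, measureReal_univ_spectralMeasure]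
  simp

theorem ext_spectralMeasure {ψ : E} {ν : Measure ℝ} [IsFiniteMeasure ν]
    (h : ∀ g : C_c(ℝ, ℝ), (⟪ψ, cfc (⇑g) (H : E →L[ℂ] E) ψ⟫_ℂ).re = ∫ x, g x ∂ν) :
    spectralMeasure H ψ = ν :=
  Measure.ext_of_integral_eq_on_compactlySupported fun g => by rw [integral_spectralMeasure, h]

theorem spectralMeasure_cfc (ψ : E) {g : ℝ → ℝ} (hg : Continuous g) :
    spectralMeasure H (cfc g (H : E →L[ℂ] E) ψ) =
      (spectralMeasure H ψ).withDensity fun x => ENNReal.ofReal (g x ^ 2) := by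
  have := isFiniteMeasure_withDensity_ofReal
    (integrable_spectralMeasure H ψ (g := fun x => g x ^ 2) (by fun_prop)).2
  refine ext_spectralMeasure H fun k => ?_
  have hk : Continuous (⇑k) := k.continuous
  rw [re_inner_cfc_cfc H ψ hg hk, integral_withDensity_eq_integral_toReal_smul
    (by fun_prop) (by simp)]
  simp [ENNReal.toReal_ofReal, sq_nonneg]

theorem spectralMeasure_cfc_absolutelyContinuous (ψ : E) {g : ℝ → ℝ} (hg : Continuous g) :
    spectralMeasure H (cfc g (H : E →L[ℂ] E) ψ) ≪ spectralMeasure H ψ := by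
  rw [spectralMeasure_cfc H ψ hg]
  exact withDensity_absolutelyContinuous _ _

/-- By the isometry, g(H)ψ sees g only almost everywhere for the spectral measure of ψ. A function
may thus be altered on a set that this measure does not charge. -/
theorem cfc_apply_congr {ψ : E} {g h : ℝ → ℝ} (hg : Continuous g) (hh : Continuous h)
    (hgh : g =ᵐ[spectralMeasure H ψ] h) :
    cfc g (H : E →L[ℂ] E) ψ = cfc h (H : E →L[ℂ] E) ψ := by
  have h1 : ‖cfc (fun x => g x - h x) (H : E →L[ℂ] E) ψ‖ ^ 2 = 0 := by
    rw [norm_cfc_apply_sq H ψ (by fun_prop), ← integral_zero ℝ ℝ (μ := spectralMeasure H ψ)]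
    refine integral_congr_ae ?_
    filter_upwards [hgh] with x hx
    simp [hx]
  rw [cfc_sub g h _ hg.continuousOn hh.continuousOn] at h1
  simpa [sub_eq_zero] using h1

end SpectralMeasure

/-! ### Approximating spectral projections by continuous functions -/

/-- Indicators are limits in `L¹` of continuous functions with values in `[0, 1]`. -/
theorem exists_seq_continuous_tendsto_indicator (ν : Measure ℝ) [IsFiniteMeasure ν] {S : Set ℝ}
    (hS : MeasurableSet S) : ∃ g : ℕ → ℝ → ℝ, (∀ n, Continuous (g n)) ∧
      (∀ n x, g n x ∈ Set.Icc (0 : ℝ) 1) ∧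
      Tendsto (fun n => ∫ x, |g n x - S.indicator 1 x| ∂ν) atTop (𝓝 0) := by
  have hi : Integrable (S.indicator (1 : ℝ → ℝ)) ν :=
    (integrable_indicator_iff hS).mpr (integrableOn_const (measure_ne_top _ _))
  choose g hgc hgε hg hgi using fun n : ℕ =>
    hi.exists_hasCompactSupport_integral_sub_le (ε := 1 / ((n : ℝ) + 1)) (by positivity)
  -- Truncating to [0, 1] does not increase the distance to an indicator, whose values lie there.
  have hcont : ∀ n, Continuous fun x => max 0 (min 1 (g n x)) := fun n => by
    have := hg n
    fun_prop
  have hle : ∀ n x, |max 0 (min 1 (g n x)) - S.indicator 1 x| ≤ ‖S.indicator 1 x - g n x‖ := by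
    intro n x
    rw [Real.norm_eq_abs, abs_sub_comm (S.indicator 1 x)]
    by_cases hx : x ∈ S <;> simp only [hx, Set.indicator_of_mem, Set.indicator_of_notMem,
      not_false_eq_true, Pi.one_apply] <;> grind
  refine ⟨fun n x => max 0 (min 1 (g n x)), hcont,
    fun n x => ⟨le_max_left _ _, by simp⟩, ?_⟩
  refine squeeze_zero (fun n => integral_nonneg fun x => abs_nonneg _) (fun n => ?_)
    tendsto_one_div_add_atTop_nhds_zero_nat
  refine le_trans (integral_mono_of_nonneg (ae_of_all _ fun x => abs_nonneg _)
    (hi.sub (hgi n)).norm (ae_of_all _ fun x => hle n x)) (hgε n)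

theorem tendsto_of_norm_sub_sq_le {E : Type*} [NormedAddCommGroup E] {x : ℕ → E} {y : E} {b : ℕ → ℝ}
    (h : ∀ n, ‖x n - y‖ ^ 2 ≤ b n) (hb : Tendsto b atTop (𝓝 0)) : Tendsto x atTop (𝓝 y) := by
  rw [tendsto_iff_norm_sub_tendsto_zero]
  have h1 : Tendsto (fun n => ‖x n - y‖ ^ 2) atTop (𝓝 0) :=
    squeeze_zero (fun n => by positivity) h hb
  simpa using h1.sqrt

section SpectralMeasure

variable {E : Type*} [NormedAddCommGroup E] [InnerProductSpace ℂ E] [CompleteSpace E]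
variable (H : selfAdjoint (E →L[ℂ] E))

theorem norm_cfc_apply_sub_sq (ψ : E) {g h : ℝ → ℝ} (hg : Continuous g) (hh : Continuous h) :
    ‖cfc g (H : E →L[ℂ] E) ψ - cfc h (H : E →L[ℂ] E) ψ‖ ^ 2 =
      ∫ x, (g x - h x) ^ 2 ∂(spectralMeasure H ψ) := by
  rw [← norm_cfc_apply_sq H ψ (g := fun x => g x - h x) (by fun_prop),
    cfc_sub g h _ hg.continuousOn hh.continuousOn]
  rfl

/-- Vectors with mutually singular spectral measures are orthogonal. -/
theorem inner_eq_zero_of_mutuallySingular {φ χ : E}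
    (h : spectralMeasure H φ ⟂ₘ spectralMeasure H χ) : ⟪φ, χ⟫_ℂ = 0 := by
  obtain ⟨S, hS, hφ, hχ⟩ := h
  -- With g_n → 1_S in L¹ of both measures and values in [0, 1], the errors also vanish in L². Thus
  -- g_n(H)φ → 0 and g_n(H)χ → χ, and moving g_n(H) across the inner product gives ⟪φ, χ⟫ = 0.
  obtain ⟨g, hg, hg01, hlim⟩ := exists_seq_continuous_tendsto_indicator
    (spectralMeasure H φ + spectralMeasure H χ) hS
  have hI : ∀ (ψ : E) (n : ℕ),
      Integrable (fun x => |g n x - S.indicator 1 x|) (spectralMeasure H ψ) := fun ψ n =>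
    ((integrable_spectralMeasure H ψ (hg n)).sub
      ((integrable_indicator_iff hS).mpr (integrableOn_const (measure_ne_top _ _)))).abs
  have hnn : ∀ (ψ : E) (n : ℕ),
      0 ≤ ∫ x, |g n x - S.indicator 1 x| ∂(spectralMeasure H ψ) :=
    fun ψ n => integral_nonneg fun x => abs_nonneg _
  have hsum : ∀ n, ∫ x, |g n x - S.indicator 1 x| ∂(spectralMeasure H φ + spectralMeasure H χ) =
      ∫ x, |g n x - S.indicator 1 x| ∂(spectralMeasure H φ) +
        ∫ x, |g n x - S.indicator 1 x| ∂(spectralMeasure H χ) := fun n =>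
    integral_add_measure (hI φ n) (hI χ n)
  have h1 : Tendsto (fun n => cfc (g n) (H : E →L[ℂ] E) φ) atTop (𝓝 0) := by
    refine tendsto_of_norm_sub_sq_le (fun n => ?_) hlim
    rw [sub_zero, norm_cfc_apply_sq H φ (hg n), hsum]
    refine le_trans (integral_mono_ae (integrable_spectralMeasure H φ (g := fun x => g n x ^ 2)
      (by have := hg n; fun_prop)) (hI φ n) ?_) (le_add_of_nonneg_right (hnn χ n))
    filter_upwards [measure_eq_zero_iff_ae_notMem.mp hφ] with x hx
    obtain ⟨ha, hb⟩ := hg01 n x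
    simp only [hx, Set.indicator_of_notMem, not_false_eq_true, sub_zero, abs_of_nonneg ha]
    nlinarith
  have h2 : Tendsto (fun n => cfc (g n) (H : E →L[ℂ] E) χ) atTop (𝓝 χ) := by
    refine tendsto_of_norm_sub_sq_le (fun n => ?_) hlim
    have e : χ = cfc (fun _ : ℝ => (1 : ℝ)) (H : E →L[ℂ] E) χ := by
      rw [show cfc (fun _ : ℝ => (1 : ℝ)) (H : E →L[ℂ] E) = 1 from cfc_one ℝ _]; rfl
    nth_rewrite 2 [e]
    rw [norm_cfc_apply_sub_sq H χ (hg n) continuous_const, hsum]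
    refine le_trans (integral_mono_ae (integrable_spectralMeasure H χ
      (g := fun x => (g n x - 1) ^ 2) (by have := hg n; fun_prop)) (hI χ n) ?_)
      (le_add_of_nonneg_left (hnn φ n))
    filter_upwards [measure_eq_zero_iff_ae_notMem.mp hχ] with x hx
    obtain ⟨ha, hb⟩ := hg01 n x
    simp only [Set.notMem_compl_iff.mp hx, Set.indicator_of_mem, Pi.one_apply]
    rw [abs_of_nonpos (by linarith)]
    nlinarith
  have h3 : Tendsto (fun n => ⟪cfc (g n) (H : E →L[ℂ] E) φ, χ⟫_ℂ) atTop (𝓝 ⟪(0 : E), χ⟫_ℂ) :=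
    h1.inner tendsto_const_nhds
  have h4 : Tendsto (fun n => ⟪φ, cfc (g n) (H : E →L[ℂ] E) χ⟫_ℂ) atTop (𝓝 ⟪φ, χ⟫_ℂ) :=
    tendsto_const_nhds.inner h2
  simp only [inner_cfc_left] at h3
  rw [inner_zero_left] at h3
  exact tendsto_nhds_unique h4 h3

/-- The restriction of a spectral measure to a Borel set is a spectral measure. -/
theorem exists_spectralMeasure_eq_restrict (ψ : E) {S : Set ℝ} (hS : MeasurableSet S) :
    ∃ φ, spectralMeasure H φ = (spectralMeasure H ψ).restrict S := by
  obtain ⟨g, hg, hg01, hlim⟩ := exists_seq_continuous_tendsto_indicator (spectralMeasure H ψ) hS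
  set e : ℕ → ℝ := fun n => ∫ x, |g n x - S.indicator 1 x| ∂(spectralMeasure H ψ) with he
  have hind : Integrable (S.indicator (1 : ℝ → ℝ)) (spectralMeasure H ψ) :=
    (integrable_indicator_iff hS).mpr (integrableOn_const (measure_ne_top _ _))
  have hI : ∀ n, Integrable (fun x => |g n x - S.indicator 1 x|) (spectralMeasure H ψ) :=
    fun n => ((integrable_spectralMeasure H ψ (hg n)).sub hind).abs
  -- Since |g_n - g_m| ≤ 1, its square is at most |g_n - g_m|, so L¹ convergence makes g_n(H)ψ
  -- Cauchy. The limit φ plays the role of 1_S(H)ψ.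
  have hdist : ∀ n m, ‖cfc (g n) (H : E →L[ℂ] E) ψ - cfc (g m) (H : E →L[ℂ] E) ψ‖ ^ 2 ≤
      e n + e m := fun n m => by
    rw [norm_cfc_apply_sub_sq H ψ (hg n) (hg m), he, ← integral_add (hI n) (hI m)]
    refine integral_mono (integrable_spectralMeasure H ψ (g := fun x => (g n x - g m x) ^ 2)
      (by have := hg n; have := hg m; fun_prop)) ((hI n).add (hI m)) fun x => ?_
    obtain ⟨ha, hb⟩ := hg01 n x
    obtain ⟨hc, hd⟩ := hg01 m x
    have h1 : |g n x - g m x| ≤ 1 := abs_le.mpr ⟨by linarith, by linarith⟩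
    have h2 := abs_sub_le (g n x) (S.indicator 1 x) (g m x)
    rw [abs_sub_comm (S.indicator 1 x)] at h2
    simp only
    rw [← sq_abs]
    nlinarith [abs_nonneg (g n x - g m x)]
  have hcauchy : CauchySeq fun n => cfc (g n) (H : E →L[ℂ] E) ψ := by
    rw [Metric.cauchySeq_iff]
    intro ε hε
    obtain ⟨N, hN⟩ := eventually_atTop.mp (hlim.eventually_lt_const (half_pos (pow_pos hε 2)))
    refine ⟨N, fun m hm n hn => ?_⟩
    rw [dist_eq_norm]
    refine lt_of_pow_lt_pow_left₀ 2 hε.le ((hdist m n).trans_lt ?_)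
    have := hN m hm
    have := hN n hn
    simp only [he]
    linarith
  obtain ⟨φ, hφ⟩ := cauchySeq_tendsto_of_complete hcauchy
  refine ⟨φ, ext_spectralMeasure H fun k => ?_⟩
  have hk : Continuous (⇑k) := k.continuous
  obtain ⟨M, hM⟩ : ∃ M, ∀ x, ‖k x‖ ≤ M := k.hasCompactSupport.exists_bound_of_continuous hk
  have h1 : Tendsto (fun n => ∫ x, g n x ^ 2 * k x ∂(spectralMeasure H ψ)) atTop
      (𝓝 (⟪φ, cfc (⇑k) (H : E →L[ℂ] E) φ⟫_ℂ).re) := by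
    simp only [← re_inner_cfc_cfc H ψ (hg _) hk]
    exact (Complex.continuous_re.tendsto _).comp
      (hφ.inner (((cfc (⇑k) (H : E →L[ℂ] E)).continuous.tendsto _).comp hφ))
  have h2 : Tendsto (fun n => ∫ x, g n x ^ 2 * k x ∂(spectralMeasure H ψ)) atTop
      (𝓝 (∫ x in S, k x ∂(spectralMeasure H ψ))) := by
    have hkS : ∫ x in S, k x ∂(spectralMeasure H ψ) =
        ∫ x, S.indicator 1 x * k x ∂(spectralMeasure H ψ) := by
      rw [← integral_indicator hS]
      congr 1 with x
      by_cases hx : x ∈ S <;> simp [hx]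
    have hi2 : Integrable (fun x => S.indicator 1 x * k x) (spectralMeasure H ψ) :=
      hind.mul_bdd (c := M) hk.aestronglyMeasurable (ae_of_all _ hM)
    have hi1 : ∀ n, Integrable (fun x => g n x ^ 2 * k x) (spectralMeasure H ψ) := fun n =>
      integrable_spectralMeasure H ψ (by have := hg n; fun_prop)
    rw [hkS, tendsto_iff_norm_sub_tendsto_zero]
    -- The factor 2M comes from g_n² - 1_S = (g_n + 1_S)(g_n - 1_S), with |g_n + 1_S| ≤ 2 and |k| ≤
    -- M.
    have hlim' := hlim.const_mul (2 * M)
    rw [mul_zero] at hlim'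
    refine squeeze_zero (fun n => norm_nonneg _) (fun n => ?_) hlim'
    rw [← integral_sub (hi1 n) hi2, ← integral_const_mul]
    refine norm_integral_le_of_norm_le ((hI n).const_mul _) (ae_of_all _ fun x => ?_)
    obtain ⟨ha, hb⟩ := hg01 n x
    have h3 : g n x ^ 2 * k x - S.indicator 1 x * k x =
        (g n x + S.indicator 1 x) * k x * (g n x - S.indicator 1 x) := by
      by_cases hx : x ∈ S <;> simp [hx] <;> ring
    have h4 : |g n x + S.indicator 1 x| ≤ 2 := by
      by_cases hx : x ∈ S <;> simp [hx] <;> rw [abs_le] <;> constructor <;> linarith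
    rw [h3, norm_mul, norm_mul, Real.norm_eq_abs, Real.norm_eq_abs (_ - _)]
    gcongr
    exact hM x
  exact tendsto_nhds_unique h1 h2

end SpectralMeasure

/-! ### Spectra of restrictions to spectral subspaces -/

section SpectralSubspace

variable {E : Type*} [NormedAddCommGroup E] [InnerProductSpace ℂ E] [CompleteSpace E]

theorem coe_algebraMap_sub_restriction (H : selfAdjoint (E →L[ℂ] E)) (M : Submodule ℂ E)
    (hM : ∀ ψ ∈ M, (H : E →L[ℂ] E) ψ ∈ M) (l : ℝ) (ψ : M) :
    (((algebraMap ℝ (M →L[ℂ] M) l -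
      (((H : E →L[ℂ] E).comp M.subtypeL).codRestrict M fun ψ => hM ψ ψ.2)) ψ : M) : E) =
      cfc (fun x => l - x) (H : E →L[ℂ] E) (ψ : E) := by
  rw [cfc_sub (fun _ => l) (fun x => x) (H : E →L[ℂ] E) continuousOn_const continuousOn_id,
    cfc_id' ℝ (H : E →L[ℂ] E), cfc_const l (H : E →L[ℂ] E)]
  simp [Algebra.algebraMap_eq_smul_one]
  rfl

/-- Both inverse identities are read in the ambient space, where l - H is a function of H, so that
the functional calculus can supply or estimate the inverse. -/
theorem notMem_restrictedSpectrum_iff (H : selfAdjoint (E →L[ℂ] E)) (M : Submodule ℂ E)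
    (hM : ∀ ψ ∈ M, (H : E →L[ℂ] E) ψ ∈ M) (l : ℝ) :
    l ∉ restrictedSpectrum H M hM ↔ ∃ B : M →L[ℂ] M,
      (∀ ψ : M, cfc (fun x => l - x) (H : E →L[ℂ] E) (B ψ : E) = ψ) ∧
      ∀ ψ χ : M, cfc (fun x => l - x) (H : E →L[ℂ] E) (ψ : E) = χ → B χ = ψ := by
  rw [restrictedSpectrum, spectrum.notMem_iff]
  constructor
  · rintro ⟨u, hu⟩
    refine ⟨(↑u⁻¹ : M →L[ℂ] M), fun ψ => ?_, fun ψ χ h => ?_⟩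
    · rw [← coe_algebraMap_sub_restriction H M hM, ← hu]
      exact congrArg (fun a : M →L[ℂ] M => ((a ψ : M) : E)) u.mul_inv
    · rw [← coe_algebraMap_sub_restriction H M hM, ← hu] at h
      rw [← Subtype.ext h]
      exact congrArg (fun a : M →L[ℂ] M => a ψ) u.inv_mul
  · rintro ⟨B, h1, h2⟩
    refine ⟨⟨_, B, ?_, ?_⟩, rfl⟩
    · ext ψ
      exact (coe_algebraMap_sub_restriction H M hM l (B ψ)).trans (h1 ψ)
    · ext ψ
      exact congrArg Subtype.val
        (h2 ψ _ (coe_algebraMap_sub_restriction H M hM l ψ).symm)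

theorem cfc_mul_apply (H : selfAdjoint (E →L[ℂ] E)) {g h : ℝ → ℝ} (hg : Continuous g)
    (hh : Continuous h) (ψ : E) : cfc (fun x => g x * h x) (H : E →L[ℂ] E) ψ =
      cfc g (H : E →L[ℂ] E) (cfc h (H : E →L[ℂ] E) ψ) := by
  rw [cfc_mul g h _ hg.continuousOn hh.continuousOn]
  rfl

/-- A point lies in the spectrum of the restriction of `H` to a spectral subspace if and only if
each of its neighbourhoods is charged by the spectral measure of a vector in that subspace. -/
theorem mem_restrictedSpectrum_spectralSubspace (H : selfAdjoint (E →L[ℂ] E))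
    {P : Measure ℝ → Prop} (h0 : P 0) (hadd : ∀ μ ν, P μ → P ν → P (μ + ν))
    (hac : ∀ μ ν, ν ≪ μ → P μ → P ν)
    (hM : ∀ ψ ∈ spectralSubspace H P h0 hadd hac,
      (H : E →L[ℂ] E) ψ ∈ spectralSubspace H P h0 hadd hac) (l : ℝ) :
    l ∈ restrictedSpectrum H (spectralSubspace H P h0 hadd hac) hM ↔
      ∀ ε > 0, ∃ ψ, P (spectralMeasure H ψ) ∧ spectralMeasure H ψ (Metric.ball l ε) ≠ 0 := by
  have hcfc : ∀ g : ℝ → ℝ, Continuous g → ∀ ψ ∈ spectralSubspace H P h0 hadd hac,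
      cfc g (H : E →L[ℂ] E) ψ ∈ spectralSubspace H P h0 hadd hac :=
    fun g hg ψ hψ => hac _ _ (spectralMeasure_cfc_absolutelyContinuous H ψ hg) hψ
  constructor
  · contrapose!
    rw [notMem_restrictedSpectrum_iff]
    rintro ⟨ε, hε, hε0⟩
    -- A continuous function equal to 1/(l - x) as soon as |l - x| ≥ ε. As no vector of the subspace
    -- charges the ball, g(H) inverts l - H there.
    let g : ℝ → ℝ := fun x => (l - x) / max ((l - x) ^ 2) (ε ^ 2)
    have hpos : ∀ x, 0 < max ((l - x) ^ 2) (ε ^ 2) := fun x => lt_max_of_lt_right (by positivity)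
    have hg : Continuous g := by
      have : ∀ x, max ((l - x) ^ 2) (ε ^ 2) ≠ 0 := fun x => (hpos x).ne'
      fun_prop (disch := assumption)
    have hone : ∀ ψ ∈ spectralSubspace H P h0 hadd hac,
        cfc (fun x => (l - x) * g x) (H : E →L[ℂ] E) ψ = ψ := by
      intro ψ hψ
      have h1 : cfc (fun x => (l - x) * g x) (H : E →L[ℂ] E) ψ =
          cfc (fun _ : ℝ => (1 : ℝ)) (H : E →L[ℂ] E) ψ := by
        refine cfc_apply_congr H (by fun_prop) continuous_const ?_
        filter_upwards [measure_eq_zero_iff_ae_notMem.mp (hε0 ψ hψ)] with x hx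
        have hx' : ε ≤ |l - x| := by
          rw [Metric.mem_ball, Real.dist_eq, abs_sub_comm] at hx
          exact not_lt.mp hx
        have hx2 : ε ^ 2 ≤ (l - x) ^ 2 := by
          rw [← sq_abs (l - x)]
          exact pow_le_pow_left₀ hε.le hx' 2
        have hne : l - x ≠ 0 := fun h => by
          rw [h, abs_zero] at hx'
          linarith
        simp only [g, max_eq_left hx2]
        field_simp
      rw [h1, show cfc (fun _ : ℝ => (1 : ℝ)) (H : E →L[ℂ] E) = 1 from cfc_one ℝ _]
      rfl
    refine ⟨((cfc g (H : E →L[ℂ] E)).comp (Submodule.subtypeL _)).codRestrict _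
      fun ψ => hcfc g hg ψ ψ.2, fun ψ => ?_, fun ψ χ h => Subtype.ext ?_⟩
    · exact (cfc_mul_apply H (by fun_prop) hg _).symm.trans (hone ψ ψ.2)
    · change cfc g (H : E →L[ℂ] E) (χ : E) = ψ
      rw [← h, ← cfc_mul_apply H hg (by fun_prop)]
      simp only [mul_comm (g _)]
      exact hone ψ ψ.2
  · intro h
    by_contra hl
    obtain ⟨B, -, hB⟩ := (notMem_restrictedSpectrum_iff H _ hM l).mp hl
    -- The added 1 keeps c positive even if B = 0, so that the radius 1/(2c) below is meaningful.
    set c : ℝ := ‖B‖ + 1 with hc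
    have hcpos : 0 < c := by positivity
    have hlin : Continuous fun x : ℝ => l - x := by fun_prop
    have hbound : ∀ ψ ∈ spectralSubspace H P h0 hadd hac,
        ‖ψ‖ ≤ c * ‖cfc (fun x => l - x) (H : E →L[ℂ] E) ψ‖ := by
      intro ψ hψ
      have h2 := B.le_opNorm ⟨_, hcfc _ hlin ψ hψ⟩
      rw [hB ⟨ψ, hψ⟩ ⟨_, hcfc _ hlin ψ hψ⟩ rfl] at h2
      refine h2.trans ?_
      gcongr
      · simp [hc]
      · exact le_rfl
    obtain ⟨ψ, hψ, hne⟩ := h (1 / (2 * c)) (by positivity)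
    set ε : ℝ := 1 / (2 * c) with hε
    have hεpos : 0 < ε := by positivity
    -- A tent supported in the closed ε-ball around l, on which |l - x| ≤ ε. The lower bound for l -
    -- H then gives ‖g(H)ψ‖ ≤ cε‖g(H)ψ‖ = ‖g(H)ψ‖/2, hence g(H)ψ = 0, although g > 0 on a ball
    -- charged by ψ.
    let g : ℝ → ℝ := fun x => max 0 (ε - |l - x|)
    have hg : Continuous g := by fun_prop
    have h1 := hbound _ (hcfc g hg ψ hψ)
    rw [← cfc_mul_apply H hlin hg] at h1
    have h2 : ‖cfc (fun x => (l - x) * g x) (H : E →L[ℂ] E) ψ‖ ^ 2 ≤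
        (ε * ‖cfc g (H : E →L[ℂ] E) ψ‖) ^ 2 := by
      rw [mul_pow, norm_cfc_apply_sq H ψ (by fun_prop), norm_cfc_apply_sq H ψ hg,
        ← integral_const_mul]
      refine integral_mono (integrable_spectralMeasure H ψ (by fun_prop))
        (integrable_spectralMeasure H ψ (g := fun x => ε ^ 2 * g x ^ 2) (by fun_prop)) fun x => ?_
      simp only [g, mul_pow]
      rcases le_total (ε - |l - x|) 0 with hx | hx
      · simp [max_eq_left hx]
      · gcongr ?_ * _
        rw [← sq_abs]
        exact pow_le_pow_left₀ (abs_nonneg _) (by linarith) 2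
    have h3 := (pow_le_pow_iff_left₀ (norm_nonneg _) (by positivity) two_ne_zero).mp h2
    have h4 : ‖cfc g (H : E →L[ℂ] E) ψ‖ ≤ 1 / 2 * ‖cfc g (H : E →L[ℂ] E) ψ‖ := by
      refine h1.trans ((mul_le_mul_of_nonneg_left h3 hcpos.le).trans (le_of_eq ?_))
      rw [hε]
      field_simp
    have h5 : ‖cfc g (H : E →L[ℂ] E) ψ‖ ^ 2 = 0 := by
      have := norm_nonneg (cfc g (H : E →L[ℂ] E) ψ)
      have : ‖cfc g (H : E →L[ℂ] E) ψ‖ = 0 := by linarith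
      rw [this]
      norm_num
    rw [norm_cfc_apply_sq H ψ hg, integral_eq_zero_iff_of_nonneg (fun x => sq_nonneg _)
      (integrable_spectralMeasure H ψ (hg.pow 2))] at h5
    refine hne (measure_eq_zero_iff_ae_notMem.mpr ?_)
    filter_upwards [h5] with x hx hxb
    rw [Metric.mem_ball, Real.dist_eq, abs_sub_comm] at hxb
    have : max 0 (ε - |l - x|) = 0 := by simpa [g] using hx
    have := le_max_right 0 (ε - |l - x|)
    linarith

/-- Rational endpoints leave only countably many conditions, so their exceptional null sets can be
united. -/
theorem mem_restrictedSpectrum_spectralSubspace_iff_rat (H : selfAdjoint (E →L[ℂ] E))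
    {P : Measure ℝ → Prop} (h0 : P 0) (hadd : ∀ μ ν, P μ → P ν → P (μ + ν))
    (hac : ∀ μ ν, ν ≪ μ → P μ → P ν)
    (hM : ∀ ψ ∈ spectralSubspace H P h0 hadd hac,
      (H : E →L[ℂ] E) ψ ∈ spectralSubspace H P h0 hadd hac) (l : ℝ) :
    l ∈ restrictedSpectrum H (spectralSubspace H P h0 hadd hac) hM ↔
      ∀ q : ℚ × ℚ, l ∈ Set.Ioo (q.1 : ℝ) q.2 →
        ∃ ψ, P (spectralMeasure H ψ) ∧ spectralMeasure H ψ (Set.Ioo (q.1 : ℝ) q.2) ≠ 0 := by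
  rw [mem_restrictedSpectrum_spectralSubspace]
  constructor
  · intro h q hq
    obtain ⟨ε, hε, hsub⟩ := Metric.isOpen_iff.mp isOpen_Ioo l hq
    obtain ⟨ψ, hP, hψ⟩ := h ε hε
    exact ⟨ψ, hP, fun h => hψ (measure_mono_null hsub h)⟩
  · intro h ε hε
    obtain ⟨a, ha, ha'⟩ := exists_rat_btwn (show l - ε < l by linarith)
    obtain ⟨b, hb, hb'⟩ := exists_rat_btwn (show l < l + ε by linarith)
    obtain ⟨ψ, hP, hψ⟩ := h (a, b) ⟨ha', hb⟩
    refine ⟨ψ, hP, fun h => hψ (measure_mono_null ?_ h)⟩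
    rw [Real.ball_eq_Ioo]
    exact Set.Ioo_subset_Ioo ha.le hb'.le

theorem isCompact_restrictedSpectrum_spectralSubspace (H : selfAdjoint (E →L[ℂ] E))
    {P : Measure ℝ → Prop} (h0 : P 0) (hadd : ∀ μ ν, P μ → P ν → P (μ + ν))
    (hac : ∀ μ ν, ν ≪ μ → P μ → P ν)
    (hM : ∀ ψ ∈ spectralSubspace H P h0 hadd hac,
      (H : E →L[ℂ] E) ψ ∈ spectralSubspace H P h0 hadd hac) :
    IsCompact (restrictedSpectrum H (spectralSubspace H P h0 hadd hac) hM) := by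
  refine Metric.isCompact_of_isClosed_isBounded ?_ ?_
  · refine isClosed_of_closure_subset fun l hl => ?_
    rw [mem_restrictedSpectrum_spectralSubspace]
    intro ε hε
    obtain ⟨l', hl', hd⟩ := Metric.mem_closure_iff.mp hl (ε / 2) (half_pos hε)
    rw [mem_restrictedSpectrum_spectralSubspace] at hl'
    obtain ⟨ψ, hP, hψ⟩ := hl' (ε / 2) (half_pos hε)
    refine ⟨ψ, hP, fun h => hψ (measure_mono_null (Metric.ball_subset_ball' ?_) h)⟩
    rw [dist_comm l' l]
    linarith
  · refine (Metric.isBounded_Icc (-‖(H : E →L[ℂ] E)‖) ‖(H : E →L[ℂ] E)‖).subset fun l hl => ?_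
    by_contra hl'
    obtain ⟨ε, hε, hsub⟩ := Metric.isOpen_iff.mp isClosed_Icc.isOpen_compl l hl'
    rw [mem_restrictedSpectrum_spectralSubspace] at hl
    obtain ⟨ψ, -, hψ⟩ := hl ε hε
    exact hψ (measure_mono_null hsub (spectralMeasure_compl_Icc H ψ))

/-- `A` carries the part of type `P` of the measure `ν`: this part is the restriction of `ν`
to `A`. -/
structure IsTypeCarrier (P : Measure ℝ → Prop) (ν : Measure ℝ) (A : Set ℝ) : Prop where
  measurableSet : MeasurableSet A
  restrict : P (ν.restrict A)
  compl_eq_zero : ∀ ρ, ρ ≪ ν → P ρ → ρ Aᶜ = 0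

/-- Whether the part of type `P` of an operator charges an open set can be read off from the
spectral measures of the vectors of a total family. -/
theorem exists_spectralMeasure_ne_zero_iff (H : selfAdjoint (E →L[ℂ] E))
    {P : Measure ℝ → Prop} (hac : ∀ μ ν, ν ≪ μ → P μ → P ν) {ι : Type*} (D : ι → E)
    (hD : ∀ ψ, (∀ i, ⟪ψ, D i⟫_ℂ = 0) → ψ = 0) {A : ι → Set ℝ}
    (hA : ∀ i, IsTypeCarrier P (spectralMeasure H (D i)) (A i)) {I : Set ℝ} (hI : IsOpen I) :
    (∃ ψ, P (spectralMeasure H ψ) ∧ spectralMeasure H ψ I ≠ 0) ↔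
      ∃ i, spectralMeasure H (D i) (A i ∩ I) ≠ 0 := by
  constructor
  · rintro ⟨ψ, hP, hψ⟩
    by_contra! hzero
    -- As g vanishes exactly off I, the vector g(H)ψ lives in I and is zero only if ψ does not
    -- charge I.
    obtain ⟨g, hg, hg0, hgI⟩ : ∃ g : ℝ → ℝ, Continuous g ∧ (∀ x ∉ I, g x = 0) ∧
        ∀ x ∈ I, g x ≠ 0 := by
      rcases Set.eq_empty_or_nonempty Iᶜ with hIe | hIne
      · exact ⟨1, continuous_const, fun x hx => absurd hx (by simp [Set.compl_empty_iff.mp hIe]),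
          fun x _ => one_ne_zero⟩
      · refine ⟨fun x => Metric.infDist x Iᶜ, by fun_prop, fun x hx =>
          Metric.infDist_zero_of_mem hx, fun x hx => ?_⟩
        exact ((hI.isClosed_compl.notMem_iff_infDist_pos hIne).mp (by simpa using hx)).ne'
    set φ := cfc g (H : E →L[ℂ] E) ψ with hφ
    have hPφ : P (spectralMeasure H φ) :=
      hac _ _ (spectralMeasure_cfc_absolutelyContinuous H ψ hg) hP
    have hφI : spectralMeasure H φ Iᶜ = 0 := by
      rw [hφ, spectralMeasure_cfc H ψ hg, withDensity_apply _ hI.measurableSet.compl,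
        setLIntegral_congr_fun (g := fun _ => 0) hI.measurableSet.compl
          (fun x hx => by simp [hg0 x hx])]
      simp
    have horth : φ = 0 := by
      refine hD φ fun i => inner_eq_zero_of_mutuallySingular H ?_
      set ν := spectralMeasure H (D i) with hν
      -- Consider the absolutely continuous part of the measure of φ relative to ν. It inherits type
      -- P, so it lives on A i; being ≪ ν it misses A i ∩ I, and being below the measure of φ it
      -- misses the complement of I. It is therefore zero, which is mutual singularity.
      have hle : ν.withDensity ((spectralMeasure H φ).rnDeriv ν) ≤ spectralMeasure H φ :=
        Measure.withDensity_rnDeriv_le _ _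
      have hρν : ν.withDensity ((spectralMeasure H φ).rnDeriv ν) ≪ ν :=
        withDensity_absolutelyContinuous _ _
      have h1 := (hA i).compl_eq_zero _ hρν
        (hac _ _ (Measure.absolutelyContinuous_of_le hle) hPφ)
      have h2 := hρν (hzero i)
      have h3 := Measure.absolutelyContinuous_of_le hle hφI
      have h4 : ν.withDensity ((spectralMeasure H φ).rnDeriv ν) = 0 := by
        rw [← Measure.measure_univ_eq_zero]
        refine measure_mono_null (t := (A i)ᶜ ∪ (A i ∩ I ∪ Iᶜ)) (fun x _ => ?_)
          (measure_union_null h1 (measure_union_null h2 h3))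
        by_cases hx : x ∈ A i <;> by_cases hx' : x ∈ I <;> simp [hx, hx']
      rw [withDensity_eq_zero_iff (by fun_prop)] at h4
      exact Measure.rnDeriv_eq_zero _ _ |>.mp h4
    rw [← spectralMeasure_eq_zero_iff H, hφ, spectralMeasure_cfc H ψ hg,
      withDensity_eq_zero_iff (by fun_prop)] at horth
    refine hψ (measure_eq_zero_iff_ae_notMem.mpr ?_)
    filter_upwards [horth] with x hx hxI
    have h5 : g x ^ 2 ≤ 0 := ENNReal.ofReal_eq_zero.mp hx
    exact hgI x hxI (by nlinarith [sq_nonneg (g x)])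
  · rintro ⟨i, hi⟩
    obtain ⟨ψ, hψ⟩ := exists_spectralMeasure_eq_restrict H (D i) (hA i).measurableSet
    refine ⟨ψ, hψ ▸ (hA i).restrict, ?_⟩
    rwa [hψ, Measure.restrict_apply hI.measurableSet, Set.inter_comm]

end SpectralSubspace

/-! ### Moments: uniqueness and measurability of spectral measures -/

section PolynomialApproximation

/-- A continuous function on `ℝ` is a locally uniform limit of polynomials. -/
theorem exists_seq_polynomial_near {g : ℝ → ℝ} (hg : Continuous g) :
    ∃ p : ℕ → Polynomial ℝ, ∀ (n : ℕ), ∀ x ∈ Set.Icc (-(n : ℝ)) n,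
      |(p n).eval x - g x| < 1 / ((n : ℝ) + 1) := by
  choose p hp using fun n : ℕ => exists_polynomial_near_of_continuousOn (-(n : ℝ)) n g
    hg.continuousOn (1 / ((n : ℝ) + 1)) (by positivity)
  exact ⟨p, hp⟩

theorem re_inner_aeval {E : Type*} [NormedAddCommGroup E] [InnerProductSpace ℂ E]
    (H : E →L[ℂ] E) (ψ : E) (p : Polynomial ℝ) :
    (⟪ψ, Polynomial.aeval H p ψ⟫_ℂ).re =
      ∑ j ∈ Finset.range (p.natDegree + 1), p.coeff j * (⟪ψ, (H ^ j) ψ⟫_ℂ).re := by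
  simp only [Polynomial.aeval_eq_sum_range, sum_apply, inner_sum, smul_apply, ← Complex.coe_smul,
    inner_smul_right, Complex.re_sum, Complex.re_ofReal_mul]

variable {E : Type*} [NormedAddCommGroup E] [InnerProductSpace ℂ E] [CompleteSpace E]

/-- Once n ≥ ‖H‖, the interval [-n, n] contains the spectrum and the operator error is at most 1/(n
+ 1). The polynomials do not depend on H, so one sequence serves all H_ω and measurability passes to
the limit. -/
theorem tendsto_re_inner_aeval (H : selfAdjoint (E →L[ℂ] E)) (ψ : E) {g : ℝ → ℝ}
    (hg : Continuous g) {p : ℕ → Polynomial ℝ}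
    (hp : ∀ (n : ℕ), ∀ x ∈ Set.Icc (-(n : ℝ)) n, |(p n).eval x - g x| < 1 / ((n : ℝ) + 1)) :
    Tendsto (fun n => (⟪ψ, Polynomial.aeval (H : E →L[ℂ] E) (p n) ψ⟫_ℂ).re) atTop
      (𝓝 (∫ x, g x ∂(spectralMeasure H ψ))) := by
  have h1 : Tendsto (fun n => Polynomial.aeval (H : E →L[ℂ] E) (p n)) atTop
      (𝓝 (cfc g (H : E →L[ℂ] E))) := by
    rw [tendsto_iff_norm_sub_tendsto_zero]
    refine squeeze_zero' (Eventually.of_forall fun n => norm_nonneg _) ?_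
      tendsto_one_div_add_atTop_nhds_zero_nat
    filter_upwards [eventually_ge_atTop ⌈‖(H : E →L[ℂ] E)‖⌉₊] with n hn
    have hH : IsSelfAdjoint (H : E →L[ℂ] E) := H.2
    rw [← cfc_polynomial (p n) (H : E →L[ℂ] E) hH,
      ← cfc_sub _ _ _ (p n).continuous.continuousOn hg.continuousOn]
    refine norm_cfc_le (by positivity) fun x hx => (hp n x ?_).le
    exact abs_le.mp ((abs_le_norm_of_mem_spectrum H hx).trans (Nat.ceil_le.mp hn))
  rw [integral_spectralMeasure_of_continuous H ψ hg]
  refine (Complex.continuous_re.tendsto _).comp (tendsto_const_nhds.inner ?_)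
  exact ((ContinuousLinearMap.apply ℂ E ψ).continuous.tendsto _).comp h1

/-- A spectral measure is determined by its moments. -/
theorem spectralMeasure_eq_of_moments {H K : selfAdjoint (E →L[ℂ] E)} {φ ψ : E}
    (h : ∀ j : ℕ, ⟪φ, ((H : E →L[ℂ] E) ^ j) φ⟫_ℂ = ⟪ψ, ((K : E →L[ℂ] E) ^ j) ψ⟫_ℂ) :
    spectralMeasure H φ = spectralMeasure K ψ := by
  refine Measure.ext_of_integral_eq_on_compactlySupported fun g => ?_
  have hg : Continuous (⇑g) := g.continuous
  obtain ⟨p, hp⟩ := exists_seq_polynomial_near hg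
  refine tendsto_nhds_unique (tendsto_re_inner_aeval H φ hg hp) ?_
  refine (tendsto_re_inner_aeval K ψ hg hp).congr fun n => ?_
  rw [re_inner_aeval, re_inner_aeval]
  simp only [h]

/-- A family of spectral measures with measurable moments is measurable. -/
theorem measurable_spectralMeasure {Ω : Type*} [MeasurableSpace Ω]
    {H : Ω → selfAdjoint (E →L[ℂ] E)} {ψ : E}
    (h : ∀ j : ℕ, Measurable fun ω => ⟪ψ, ((H ω : E →L[ℂ] E) ^ j) ψ⟫_ℂ) :
    Measurable fun ω => spectralMeasure (H ω) ψ := by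
  have hint : ∀ g : ℝ → ℝ, Continuous g →
      Measurable fun ω => ∫ x, g x ∂(spectralMeasure (H ω) ψ) := by
    intro g hg
    obtain ⟨p, hp⟩ := exists_seq_polynomial_near hg
    refine measurable_of_tendsto_metrizable (fun n => ?_)
      (tendsto_pi_nhds.mpr fun ω => tendsto_re_inner_aeval (H ω) ψ hg hp)
    simp only [re_inner_aeval]
    exact Finset.measurable_sum _ fun j _ => (Complex.measurable_re.comp (h j)).const_mul _
  have hclosed : ∀ s : Set ℝ, IsClosed s → Measurable fun ω => spectralMeasure (H ω) ψ s := by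
    intro s hs
    have hfin : ∀ n : ℕ, Measurable fun ω =>
        ∫⁻ x, (hs.apprSeq n x : ℝ≥0∞) ∂(spectralMeasure (H ω) ψ) := by
      intro n
      have hc : Continuous fun x => ((hs.apprSeq n x : NNReal) : ℝ) := by fun_prop
      convert! (hint _ hc).ennreal_ofReal using 2 with ω
      rw [ofReal_integral_eq_lintegral_ofReal (integrable_spectralMeasure _ ψ hc)
        (ae_of_all _ fun x => NNReal.coe_nonneg _)]
      simp
    refine measurable_of_tendsto_metrizable hfin (tendsto_pi_nhds.mpr fun ω => ?_)
    exact HasOuterApproxClosed.tendsto_lintegral_apprSeq hs _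
  refine Measurable.measure_of_isPiSystem (borel_eq_generateFrom_isClosed (α := ℝ) ▸
    BorelSpace.measurable_eq) isPiSystem_isClosed (fun s hs => hclosed s hs)
    (hclosed _ isClosed_univ)

end PolynomialApproximation

/-! ### The operators H_ω: measurability and covariance -/

section DynamicalSchrodinger

variable {Ω : Type*} [MeasurableSpace Ω]

/-- The unit vector of `ℓ²(ℤ)` at the site `k`. -/
noncomputable def siteVector (k : ℤ) : EllTwo := lp.single 2 k 1

theorem siteVector_apply (k m : ℤ) : siteVector k m = if m = k then 1 else 0 := by
  simp [siteVector, Pi.single_apply]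

theorem inner_siteVector_left (k : ℤ) (u : EllTwo) : ⟪siteVector k, u⟫_ℂ = u k := by
  simp [siteVector, lp.inner_single_left]

theorem inner_siteVector_right (k : ℤ) (u : EllTwo) :
    ⟪u, siteVector k⟫_ℂ = (starRingEnd ℂ) (u k) := by
  rw [← inner_conj_symm, inner_siteVector_left]

theorem dynSchrodinger_apply (T : Ω ≃ᵐ Ω) (f : Ω → ℝ) (hf : ∃ C : ℝ, ∀ ω, |f ω| ≤ C) (ω : Ω)
    (u : EllTwo) (n : ℤ) : (dynSchrodinger T f hf ω : EllTwo →L[ℂ] EllTwo) u n =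
      u (n - 1) + u (n + 1) + (f (((T.toEquiv : Equiv.Perm Ω) ^ n) ω) : ℂ) * u n :=
  rfl

theorem dynSchrodinger_pow_succ_apply (T : Ω ≃ᵐ Ω) (f : Ω → ℝ) (hf : ∃ C : ℝ, ∀ ω, |f ω| ≤ C)
    (ω : Ω) (j : ℕ) (u : EllTwo) (n : ℤ) :
    ((dynSchrodinger T f hf ω : EllTwo →L[ℂ] EllTwo) ^ (j + 1)) u n =
      ((dynSchrodinger T f hf ω : EllTwo →L[ℂ] EllTwo) ^ j) u (n - 1) +
      ((dynSchrodinger T f hf ω : EllTwo →L[ℂ] EllTwo) ^ j) u (n + 1) +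
      (f (((T.toEquiv : Equiv.Perm Ω) ^ n) ω) : ℂ) *
        ((dynSchrodinger T f hf ω : EllTwo →L[ℂ] EllTwo) ^ j) u n := by
  rw [pow_succ', mul_apply_eq_comp, dynSchrodinger_apply]

theorem MeasurableEquiv.measurable_zpow (T : Ω ≃ᵐ Ω) (n : ℤ) :
    Measurable fun ω => ((T.toEquiv : Equiv.Perm Ω) ^ n) ω := by
  induction n with
  | zero => exact measurable_id
  | succ n ih =>
    simp only [zpow_add, zpow_one, Equiv.Perm.mul_apply] at ih ⊢
    exact ih.comp T.measurable
  | pred n ih =>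
    simp only [zpow_sub, zpow_one, Equiv.Perm.mul_apply] at ih ⊢
    exact ih.comp T.symm.measurable

theorem measurable_dynSchrodinger_pow_apply (T : Ω ≃ᵐ Ω) {f : Ω → ℝ} (hfm : Measurable f)
    (hf : ∃ C : ℝ, ∀ ω, |f ω| ≤ C) (u : EllTwo) (j : ℕ) (n : ℤ) :
    @Measurable Ω ℂ _ _ fun ω =>
      ((dynSchrodinger T f hf ω : EllTwo →L[ℂ] EllTwo) ^ j) u n := by
  induction j generalizing n with
  | zero => simp
  | succ j ih =>
    simp only [dynSchrodinger_pow_succ_apply]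
    have := hfm.comp (MeasurableEquiv.measurable_zpow T n)
    exact ((ih _).add (ih _)).add ((Complex.measurable_ofReal.comp this).mul (ih _))

/-- The shift intertwines H_{Tω} with H_ω, since the potential of Tω at n is that of ω at n + 1. The
entrywise form permits induction on the power. -/
theorem dynSchrodinger_pow_siteVector_covariant (T : Ω ≃ᵐ Ω) (f : Ω → ℝ)
    (hf : ∃ C : ℝ, ∀ ω, |f ω| ≤ C) (ω : Ω) (k : ℤ) (j : ℕ) (n : ℤ) :
    ((dynSchrodinger T f hf (T ω) : EllTwo →L[ℂ] EllTwo) ^ j) (siteVector k) n =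
      ((dynSchrodinger T f hf ω : EllTwo →L[ℂ] EllTwo) ^ j) (siteVector (k + 1)) (n + 1) := by
  induction j generalizing n with
  | zero => simp [siteVector_apply]
  | succ j ih =>
    have h1 : ((T.toEquiv : Equiv.Perm Ω) ^ (n + 1)) ω =
        ((T.toEquiv : Equiv.Perm Ω) ^ n) (T ω) := by
      rw [zpow_add, zpow_one, Equiv.Perm.mul_apply]
      rfl
    rw [dynSchrodinger_pow_succ_apply, dynSchrodinger_pow_succ_apply, ih, ih, ih, h1]
    simp

/-- Covariance: moving the point along the orbit translates the site. -/
theorem spectralMeasure_dynSchrodinger_covariant (T : Ω ≃ᵐ Ω) (f : Ω → ℝ)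
    (hf : ∃ C : ℝ, ∀ ω, |f ω| ≤ C) (ω : Ω) (k : ℤ) :
    spectralMeasure (dynSchrodinger T f hf (T ω)) (siteVector k) =
      spectralMeasure (dynSchrodinger T f hf ω) (siteVector (k + 1)) :=
  spectralMeasure_eq_of_moments fun j => by
    rw [inner_siteVector_left, inner_siteVector_left, dynSchrodinger_pow_siteVector_covariant]

/-- The spectral measures at a site as a kernel. -/
noncomputable def siteKernel (T : Ω ≃ᵐ Ω) {f : Ω → ℝ} (hfm : Measurable f)
    (hf : ∃ C : ℝ, ∀ ω, |f ω| ≤ C) (k : ℤ) : ProbabilityTheory.Kernel Ω ℝ where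
  toFun ω := spectralMeasure (dynSchrodinger T f hf ω) (siteVector k)
  measurable' := measurable_spectralMeasure fun j => by
    simp only [inner_siteVector_left]
    exact measurable_dynSchrodinger_pow_apply T hfm hf _ j k

instance isFiniteKernel_siteKernel (T : Ω ≃ᵐ Ω) {f : Ω → ℝ} (hfm : Measurable f)
    (hf : ∃ C : ℝ, ∀ ω, |f ω| ≤ C) (k : ℤ) :
    ProbabilityTheory.IsFiniteKernel (siteKernel T hfm hf k) := by
  refine ⟨⟨ENNReal.ofReal (‖siteVector k‖ ^ 2), ENNReal.ofReal_lt_top, fun ω => ?_⟩⟩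
  rw [← measureReal_univ_spectralMeasure (dynSchrodinger T f hf ω), ofReal_measureReal]
  rfl

end DynamicalSchrodinger

/-! ### Jointly measurable carriers of the three types -/

section Carriers

open ProbabilityTheory

variable {Ω : Type*} [MeasurableSpace Ω] (κ : Kernel Ω ℝ)

/-- With x adjoined as a parameter, {x} becomes a section of the measurable diagonal. -/
theorem Kernel.measurableSet_noAtom [IsFiniteKernel κ] :
    MeasurableSet {p : Ω × ℝ | κ p.1 {p.2} = 0} := by
  have hd : MeasurableSet {q : (Ω × ℝ) × ℝ | q.2 = q.1.2} :=
    measurableSet_eq_fun measurable_snd (measurable_snd.comp measurable_fst)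
  exact Kernel.measurable_kernel_prodMk_left (κ := Kernel.prodMkRight ℝ κ) hd
    (measurableSet_singleton 0)

theorem countable_atoms (ν : Measure ℝ) [IsFiniteMeasure ν] : {x | ν {x} ≠ 0}.Countable := by
  have h := Measure.countable_meas_level_set_pos (μ := ν) measurable_id
  refine h.mono fun x hx => ?_
  exact pos_iff_ne_zero.mpr hx

theorem measure_eq_zero_of_countable {ν : Measure ℝ} {S : Set ℝ} (hS : S.Countable)
    (h : ∀ x ∈ S, ν {x} = 0) : ν S = 0 := by
  rw [← Set.biUnion_of_singleton S]
  exact (measure_biUnion_null_iff hS).mpr h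

theorem exists_measurableSet_singular [IsFiniteKernel κ] :
    ∃ N : Set (Ω × ℝ), MeasurableSet N ∧ ∀ ω, volume (Prod.mk ω ⁻¹' N) = 0 ∧
      (κ ω).restrict (Prod.mk ω ⁻¹' N)ᶜ ≪ volume := by
  -- A finite measure with the same null sets as Lebesgue measure, to which the decomposition of
  -- finite kernels applies.
  let η : Kernel Ω ℝ := Kernel.const Ω (volume : Measure ℝ).toFinite
  refine ⟨Kernel.mutuallySingularSet κ η, Kernel.measurableSet_mutuallySingularSet κ η,
    fun ω => ⟨?_, ?_⟩⟩
  · exact absolutelyContinuous_toFinite _ (Kernel.measure_mutuallySingularSetSlice κ η ω)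
  · refine Measure.AbsolutelyContinuous.mk fun s hs h => ?_
    have hN := Kernel.measurableSet_mutuallySingularSetSlice κ η ω
    change (κ ω).restrict (Kernel.mutuallySingularSetSlice κ η ω)ᶜ s = 0
    rw [Measure.restrict_apply hs,
      ← Kernel.withDensity_rnDeriv_of_subset_compl_mutuallySingularSetSlice
      (hs.inter hN.compl) Set.inter_subset_right, Kernel.withDensity_apply' _ (by fun_prop)]
    exact setLIntegral_measure_zero _ _
      (measure_mono_null Set.inter_subset_left (toFinite_absolutelyContinuous _ h))

theorem exists_carrier_absolutelyContinuous [IsFiniteKernel κ] :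
    ∃ A : Set (Ω × ℝ), MeasurableSet A ∧
      ∀ ω, IsTypeCarrier (fun μ => μ ≪ volume) (κ ω) (Prod.mk ω ⁻¹' A) := by
  obtain ⟨N, hN, h⟩ := exists_measurableSet_singular κ
  refine ⟨Nᶜ, hN.compl, fun ω => ⟨measurable_prodMk_left hN.compl, (h ω).2, fun ρ _ hρ => ?_⟩⟩
  rw [← Set.preimage_compl, compl_compl]
  exact hρ (h ω).1

/-- The singular part lives on N, and discarding atoms leaves its continuous part. Conversely, a
singular ρ ≪ κ ω cannot charge the complement of N, where it would be absolutely continuous; if ρ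
has no atoms, it does not charge the countably many atoms of κ ω either. -/
theorem exists_carrier_singularContinuous [IsFiniteKernel κ] :
    ∃ A : Set (Ω × ℝ), MeasurableSet A ∧ ∀ ω,
      IsTypeCarrier (fun μ => μ ⟂ₘ volume ∧ ∀ x, μ {x} = 0) (κ ω) (Prod.mk ω ⁻¹' A) := by
  obtain ⟨N, hN, h⟩ := exists_measurableSet_singular κ
  have hA := Kernel.measurableSet_noAtom κ
  refine ⟨N ∩ {p : Ω × ℝ | κ p.1 {p.2} = 0}, hN.inter hA, fun ω =>
    ⟨measurable_prodMk_left (hN.inter hA), ⟨?_, fun x => ?_⟩, fun ρ hρκ hρ => ?_⟩⟩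
  · refine ⟨(Prod.mk ω ⁻¹' N)ᶜ, (measurable_prodMk_left hN).compl, ?_, ?_⟩
    · rw [Measure.restrict_apply (measurable_prodMk_left hN).compl]
      refine measure_mono_null ?_ measure_empty
      rintro x ⟨hx, hx', -⟩
      exact hx hx'
    · rw [compl_compl]
      exact (h ω).1
  · rw [Measure.restrict_apply (measurableSet_singleton x)]
    by_cases hx : κ ω {x} = 0
    · exact measure_mono_null Set.inter_subset_left hx
    · refine measure_mono_null ?_ measure_empty
      rintro y ⟨rfl, -, hy⟩
      exact hx hy
  · have h1 : ρ (Prod.mk ω ⁻¹' N)ᶜ = 0 := by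
      have h2 : ρ.restrict (Prod.mk ω ⁻¹' N)ᶜ ≪ volume := (hρκ.restrict _).trans (h ω).2
      have h3 : ρ.restrict (Prod.mk ω ⁻¹' N)ᶜ ⟂ₘ volume := hρ.1.restrict _
      exact Measure.restrict_eq_zero.mp (Measure.eq_zero_of_absolutelyContinuous_of_mutuallySingular
        h2 h3)
    rw [Set.preimage_inter, Set.compl_inter]
    exact measure_union_null h1
      (measure_eq_zero_of_countable (countable_atoms (κ ω)) fun x _ => hρ.2 x)

/-- The carrier is the set of atoms. If ρ ≪ κ ω lives on a countable S, each non-atom of κ ω in S is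
ρ-null, and countably many of them remain null. -/
theorem exists_carrier_purePoint [IsFiniteKernel κ] :
    ∃ A : Set (Ω × ℝ), MeasurableSet A ∧ ∀ ω,
      IsTypeCarrier (fun μ => ∃ S : Set ℝ, S.Countable ∧ μ Sᶜ = 0) (κ ω) (Prod.mk ω ⁻¹' A) := by
  have hA := Kernel.measurableSet_noAtom κ
  refine ⟨{p : Ω × ℝ | κ p.1 {p.2} = 0}ᶜ, hA.compl, fun ω =>
    ⟨measurable_prodMk_left hA.compl, ?_, ?_⟩⟩
  · refine ⟨_, countable_atoms (κ ω), ?_⟩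
    rw [Measure.restrict_apply (countable_atoms (κ ω)).measurableSet.compl]
    exact measure_mono_null (fun x hx => hx.1 hx.2) measure_empty
  · rintro ρ hρκ ⟨S, hS, hρS⟩
    rw [← Set.preimage_compl, compl_compl]
    refine measure_mono_null (t := Sᶜ ∪ (S ∩ Prod.mk ω ⁻¹' {p : Ω × ℝ | κ p.1 {p.2} = 0}))
      (fun x hx => ?_) (measure_union_null hρS ?_)
    · by_cases hxS : x ∈ S
      · exact Or.inr ⟨hxS, hx⟩
      · exact Or.inl hxS
    · exact measure_eq_zero_of_countable (hS.mono Set.inter_subset_left) fun x hx => hρκ hx.2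

end Carriers

/-! ### Ergodicity and almost sure constancy -/

/-- For a shift invariant spectral type whose carriers depend measurably on the point, the
spectrum of that type is almost surely constant. -/
theorem exists_isCompact_ae_restrictedSpectrum_eq {Ω : Type*} [MeasurableSpace Ω]
    {μ : Measure Ω} (hμ : μ ≠ 0) (T : Ω ≃ᵐ Ω) (hT : Ergodic T μ)
    {f : Ω → ℝ} (hfm : Measurable f) (hfb : ∃ C : ℝ, ∀ ω, |f ω| ≤ C)
    {P : Measure ℝ → Prop} (h0 : P 0) (hadd : ∀ μ ν, P μ → P ν → P (μ + ν))
    (hac : ∀ μ ν, ν ≪ μ → P μ → P ν)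
    (hM : ∀ H : selfAdjoint (EllTwo →L[ℂ] EllTwo), ∀ ψ ∈ spectralSubspace H P h0 hadd hac,
      (H : EllTwo →L[ℂ] EllTwo) ψ ∈ spectralSubspace H P h0 hadd hac)
    (hcar : ∀ κ : ProbabilityTheory.Kernel Ω ℝ, ProbabilityTheory.IsFiniteKernel κ →
      ∃ A : Set (Ω × ℝ), MeasurableSet A ∧ ∀ ω, IsTypeCarrier P (κ ω) (Prod.mk ω ⁻¹' A)) :
    ∃ S : Set ℝ, IsCompact S ∧ ∀ᵐ ω ∂μ, restrictedSpectrum (dynSchrodinger T f hfb ω)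
      (spectralSubspace (dynSchrodinger T f hfb ω) P h0 hadd hac) (hM _) = S := by
  choose A hAm hA using fun k : ℤ => hcar (siteKernel T hfm hfb k) inferInstance
  let B : ℚ × ℚ → Set Ω := fun q => {ω | ∃ ψ, P (spectralMeasure (dynSchrodinger T f hfb ω) ψ) ∧
    spectralMeasure (dynSchrodinger T f hfb ω) ψ (Set.Ioo (q.1 : ℝ) q.2) ≠ 0}
  have htotal : ∀ ψ : EllTwo, (∀ k, ⟪ψ, siteVector k⟫_ℂ = 0) → ψ = 0 := by
    intro ψ h
    ext k
    simpa [inner_siteVector_right] using h k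
  have hB : ∀ q ω, ω ∈ B q ↔ ∃ k, siteKernel T hfm hfb k ω
      (Prod.mk ω ⁻¹' (A k) ∩ Set.Ioo (q.1 : ℝ) q.2) ≠ 0 := fun q ω =>
    exists_spectralMeasure_ne_zero_iff _ hac siteVector htotal (fun k => hA k ω) isOpen_Ioo
  have hBm : ∀ q, MeasurableSet (B q) := by
    intro q
    have e : B q = ⋃ k, {ω | siteKernel T hfm hfb k ω
        (Prod.mk ω ⁻¹' (A k ∩ Prod.snd ⁻¹' Set.Ioo (q.1 : ℝ) q.2)) ≠ 0} := by
      ext ω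
      simp only [hB, Set.mem_iUnion]
      rfl
    rw [e]
    refine MeasurableSet.iUnion fun k => ?_
    exact ProbabilityTheory.Kernel.measurable_kernel_prodMk_left
      ((hAm k).inter (measurable_snd measurableSet_Ioo)) (measurableSet_singleton 0).compl
  have hBinv : ∀ q, T ⁻¹' (B q) = B q := by
    intro q
    ext ω
    -- At ω the criterion is applied to the translated family δ_{k+1}, whose spectral measures are
    -- those of δ_k at Tω. The carriers at Tω then serve directly, and no covariance of the chosen
    -- sets A k is needed.
    have h1 : (∃ ψ, P (spectralMeasure (dynSchrodinger T f hfb ω) ψ) ∧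
        spectralMeasure (dynSchrodinger T f hfb ω) ψ (Set.Ioo (q.1 : ℝ) q.2) ≠ 0) ↔ _ :=
      exists_spectralMeasure_ne_zero_iff _ hac (fun k => siteVector (k + 1))
        (fun ψ h => htotal ψ fun k => by simpa using h (k - 1))
        (A := fun k => Prod.mk (T ω) ⁻¹' (A k)) (fun k => by
          rw [← spectralMeasure_dynSchrodinger_covariant]
          exact hA k (T ω)) isOpen_Ioo
    rw [Set.mem_preimage, hB, show ω ∈ B q ↔ _ from h1]
    refine exists_congr fun k => ?_
    rw [← spectralMeasure_dynSchrodinger_covariant]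
    rfl
  have hconst : ∀ q, ∃ c : Prop, ∀ᵐ ω ∂μ, (ω ∈ B q ↔ c) := by
    intro q
    rcases hT.toPreErgodic.ae_mem_or_ae_notMem (hBm q) (hBinv q) with h | h
    · exact ⟨True, h.mono fun ω hω => by simpa using hω⟩
    · exact ⟨False, h.mono fun ω hω => by simpa using hω⟩
  choose c hc using hconst
  have hall : ∀ᵐ ω ∂μ, ∀ q, (ω ∈ B q ↔ c q) := ae_all_iff.mpr hc
  have : (ae μ).NeBot := ae_neBot.mpr hμ
  -- The constant set is the spectrum at one typical point, from which it inherits compactness.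
  obtain ⟨ω₀, hω₀⟩ := hall.exists
  refine ⟨_, isCompact_restrictedSpectrum_spectralSubspace (dynSchrodinger T f hfb ω₀) h0 hadd hac
    (hM _), hall.mono fun ω hω => ?_⟩
  ext l
  rw [mem_restrictedSpectrum_spectralSubspace_iff_rat,
    mem_restrictedSpectrum_spectralSubspace_iff_rat]
  exact forall_congr' fun q => imp_congr_right fun _ => (hω q).trans (hω₀ q).symm

theorem mainTheorem4 {Ω : Type*} [MeasurableSpace Ω] (μ : Measure Ω) [SigmaFinite μ]
    (hμ : μ Set.univ = ∞) (T : Ω ≃ᵐ Ω) (hT : Ergodic T μ) (hTc : Conservative T μ)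
    (f : Ω → ℝ) (hfm : Measurable f) (hfb : ∃ C : ℝ, ∀ ω, |f ω| ≤ C) :
    ∃ Sac Ssc Spp : Set ℝ, IsCompact Sac ∧ IsCompact Ssc ∧ IsCompact Spp ∧
      ∀ᵐ ω ∂μ, acSpectrum (dynSchrodinger T f hfb ω) = Sac ∧
        scSpectrum (dynSchrodinger T f hfb ω) = Ssc ∧
        ppSpectrum (dynSchrodinger T f hfb ω) = Spp := by
  have hμ0 : μ ≠ 0 := fun h => by simp [h] at hμ
  obtain ⟨Sac, hSac, hac⟩ := exists_isCompact_ae_restrictedSpectrum_eq hμ0 T hT hfm hfb _ _ _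
    acSubspace_invariant fun κ _ => exists_carrier_absolutelyContinuous κ
  obtain ⟨Ssc, hSsc, hsc⟩ := exists_isCompact_ae_restrictedSpectrum_eq hμ0 T hT hfm hfb _ _ _
    scSubspace_invariant fun κ _ => exists_carrier_singularContinuous κ
  obtain ⟨Spp, hSpp, hpp⟩ := exists_isCompact_ae_restrictedSpectrum_eq hμ0 T hT hfm hfb _ _ _
    ppSubspace_invariant fun κ _ => exists_carrier_purePoint κ
  refine ⟨Sac, Ssc, Spp, hSac, hSsc, hSpp, ?_⟩
  filter_upwards [hac, hsc, hpp] with ω h1 h2 h3 using ⟨h1, h2, h3⟩
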